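/- Consider the one-agent probability language, whose formulas are built from propositional letters $p_1,p_2,\dots$ by $\neg$, $\wedge$ and the modalities $L_r$ ($r\in\mathbb{Q}\cap[0,1]$; "the probability is at least $r$"). The depth of a formula is the maximal nesting of the modalities $L_r$ in it. Let $\Sigma_H$ be the smallest set of formulas that contains all propositional tautologies and all instances of - $L_0\varphi$; - $L_r\top$; - $L_r(\varphi\wedge\psi)\wedge L_t(\varphi\wedge\neg\psi)\to L_{r+t}\varphi$ and $\neg L_r(\varphi\wedge\psi)\wedge\neg L_t(\varphi\wedge\neg\psi)\to\neg L_{r+t}\varphi$, for $r+t\le 1$; - $L_r\varphi\to\neg L_s\neg\varphi$, for $r+s>1$; - $L_r\varphi\to L_1L_r\varphi$ and $\neg L_r\varphi\to L_1\neg L_r\varphi$, and is closed under modus ponens, uniform substitution, the rule "from $\varphi\leftrightarrow\psi$ infer $L_r\varphi\leftrightarrow L_r\psi$", and the infinitary rule "if $\gamma\to L_s\varphi$ is in the set for all rational $s\in[0,r)$, then so is $\gamma\to L_r\varphi$". A set of formulas is $\Sigma_H$-consistent if no finite subset $\{\varphi_1,\dots,\varphi_n\}$ of it has $\varphi_1\wedge\dots\wedge\varphi_n\to\bot$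 in $\Sigma_H$. For a set $\Lambda$ of formulas (a restricted language), a maximal consistent set in $\Lambda$ is a $\Sigma_H$-consistent subset of $\Lambda$ that is not properly contained in another $\Sigma_H$-consistent subset of $\Lambda$. **Theorem.** 1. Let $I\subset\mathbb{Q}\cap[0,1]$ be finite and let $P$ be a finite set of propositional letters. Then the canonical space of $\Sigma_H$ in the language restricted to the indices in $I$ and the letters in $P$, i.e. the set of all maximal consistent sets in the language of all formulas (of any depth) with indices in $I$ and letters in $P$, is finite. 2. For integers $q\ge 1$ and $d,w\ge 0$ let $\Omega_H(q,d,w)$ be the set of all maximal consistent sets in the language of formulas of depth at most $d$ whose letters are among the first $w$ letters and whose indices are multiples of $1/q$ in $[0,1]$. Then $\Omega_H(q,d,w)$ is finite, and $|\Omega_H(q,d,w)|=|\Omega_H(q,d+k,w)|$ for all $d\ge 1$ and $k\ge 0$. 3. With one letter, $|\Omega_H(q,d,1)|=2(2q+1)$ for all $q\ge 1$ and $d\ge 1$. -/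

import Mathlib

namespace HarsanyiLogic

/-- The admissible probability indices: the rationals in the closed interval from 0 to 1. -/
abbrev Index : Type := Set.Icc (0 : ℚ) 1

/-- Formulas of the one-agent probability language; `letter n` is the n-th propositional letter,
`bel r φ` is the formula with the modality "the probability of φ is at least r". -/
inductive Formula : Type where
  | letter (n : ℕ) : Formula
  | neg (φ : Formula) : Formula
  | and (φ ψ : Formula) : Formula
  | bel (r : Index) (φ : Formula) : Formula

namespace Formula

/-- Material implication. -/
def imp (φ ψ : Formula) : Formula := neg (and φ (neg ψ))

/-- Biconditional. -/
def iff (φ ψ : Formula) : Formula := and (imp φ ψ) (imp ψ φ)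

/-- Falsum. -/
def bot : Formula := and (letter 0) (neg (letter 0))

/-- Verum. -/
def top : Formula := neg bot

/-- Conjunction of a finite list of formulas. -/
def conj : List Formula → Formula
  | [] => top
  | φ :: l => and φ (conj l)

/-- Simultaneous substitution of formulas for the propositional letters. -/
def subst (σ : ℕ → Formula) : Formula → Formula
  | letter n => σ n
  | neg φ => neg (subst σ φ)
  | and φ ψ => and (subst σ φ) (subst σ ψ)
  | bel r φ => bel r (subst σ φ)

/-- Depth of nesting of the probability modalities. -/
def depth : Formula → ℕ
  | letter _ => 0
  | neg φ => depth φ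
  | and φ ψ => max (depth φ) (depth ψ)
  | bel _ φ => depth φ + 1

/-- All letters occurring in the formula lie in `P` and all indices occurring in it lie in `I`. -/
def Over (I : Set Index) (P : Set ℕ) : Formula → Prop
  | letter n => n ∈ P
  | neg φ => Over I P φ
  | and φ ψ => Over I P φ ∧ Over I P ψ
  | bel r φ => r ∈ I ∧ Over I P φ

/-- Propositional tautologies: formulas true under every two-valued assignment that respects the
Boolean connectives (formulas beginning with a modality are treated as atoms). -/
def IsTautology (φ : Formula) : Prop :=
  ∀ e : Formula → Bool,
    (∀ α, e (neg α) = !(e α)) → (∀ α β, e (and α β) = (e α && e β)) → e φ = true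

end Formula

open Formula

/-- Theoremhood in the probability logic of Harsanyi type spaces: the smallest set of formulas
containing the tautologies and the axiom schemes below that is closed under modus ponens,
uniform substitution, (DIS) and the infinitary rule (ARCH). -/
inductive SigmaH : Formula → Prop where
  | taut (φ : Formula) (h : IsTautology φ) : SigmaH φ
  | A1 (r : Index) (hr : (r : ℚ) = 0) (φ : Formula) : SigmaH (bel r φ)
  | A2 (r : Index) : SigmaH (bel r top)
  | A3 (r t s : Index) (hs : (s : ℚ) = r + t) (φ ψ : Formula) :
      SigmaH (imp (and (bel r (and φ ψ)) (bel t (and φ (neg ψ)))) (bel s φ))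
  | A4 (r t s : Index) (hs : (s : ℚ) = r + t) (φ ψ : Formula) :
      SigmaH (imp (and (neg (bel r (and φ ψ))) (neg (bel t (and φ (neg ψ))))) (neg (bel s φ)))
  | A5 (r s : Index) (hrs : (1 : ℚ) < r + s) (φ : Formula) :
      SigmaH (imp (bel r φ) (neg (bel s (neg φ))))
  | four (r one : Index) (h1 : (one : ℚ) = 1) (φ : Formula) :
      SigmaH (imp (bel r φ) (bel one (bel r φ)))
  | five (r one : Index) (h1 : (one : ℚ) = 1) (φ : Formula) :
      SigmaH (imp (neg (bel r φ)) (bel one (neg (bel r φ))))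
  | mp (φ ψ : Formula) (h : SigmaH (imp φ ψ)) (hφ : SigmaH φ) : SigmaH ψ
  | unifSubst (σ : ℕ → Formula) (φ : Formula) (h : SigmaH φ) : SigmaH (subst σ φ)
  | dis (r : Index) (φ ψ : Formula) (h : SigmaH (Formula.iff φ ψ)) :
      SigmaH (Formula.iff (bel r φ) (bel r ψ))
  | arch (r : Index) (γ φ : Formula) (h : ∀ s : Index, s < r → SigmaH (imp γ (bel s φ))) :
      SigmaH (imp γ (bel r φ))

/-- A set of formulas is consistent if no conjunction of finitely many of its members provably
implies falsum. -/
def Consistent (Γ : Set Formula) : Prop :=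
  ∀ l : List Formula, (∀ φ ∈ l, φ ∈ Γ) → ¬ SigmaH (imp (conj l) bot)

/-- The maximal consistent sets of formulas of a (restricted) language `Λ`. -/
def atoms (Λ : Set Formula) : Set (Set Formula) :=
  {Γ | Maximal (fun Δ : Set Formula => Δ ⊆ Λ ∧ Consistent Δ) Γ}

/-- The language with probability indices in `I` and propositional letters in `P`, with formulas
of every depth. -/
def language (I : Set Index) (P : Set ℕ) : Set Formula := {φ | Over I P φ}

/-- The canonical space of the logic in the language with indices in `I` and letters in `P`. -/
def canonicalSpace (I : Set Index) (P : Set ℕ) : Set (Set Formula) := atoms (language I P)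

/-- The multiples of `1/q` in the unit interval. -/
def multiples (q : ℕ) : Set Index := {r | ∃ k : ℕ, (r : ℚ) = (k : ℚ) / (q : ℚ)}

/-- The local language of accuracy `q`, depth at most `d`, in the first `w` letters. -/
def localLanguage (q d w : ℕ) : Set Formula :=
  {φ | φ ∈ language (multiples q) {n | n < w} ∧ depth φ ≤ d}

/-- The set of atoms of the local language of accuracy `q`, depth at most `d`, in the first `w`
letters. -/
def OmegaH (q d w : ℕ) : Set (Set Formula) := atoms (localLanguage q d w)

end HarsanyiLogic

/-! Introspection collapses depth. A maximal consistent set Γ gives probability one to each belief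
formula in it and to the negation of each one outside it. So, up to probability one in Γ, the
outermost modal subformulas of φ may be replaced by truth values (`flatten`), and `bel r φ` is
equivalent in Γ to `bel r` of a modality-free formula. By induction on depth, Γ is determined by its
members of depth at most one (`IsMCS.mem_iff_of_agree`). Only finitely many truth tables and indices
are available there, which gives finiteness; and restricting atoms from depth `d + k` to depth `d ≥
1` is bijective.

With one letter p, a modality-free formula is equivalent to ⊤, ⊥, p or ¬p. So Γ is given by the
truth value of p and the largest a, b for which the probability of p is at least a/q and that of ¬p
at least b/q. The axioms force a + b to be q or q - 1, which leaves (q + 1) + q pairs, doubled by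
the truth value of p. Each case occurs in a two-state model where p has probability c/(2q) with 0 ≤
c ≤ 2q (`IsMCS.exists_stateTheory`); `SigmaH.sound` makes its theories consistent. -/

namespace HarsanyiLogic

open Formula

/-! ### Propositional reasoning inside the logic -/

/-- Two-valued assignments that respect the Boolean connectives. -/
def IsBoolean (e : Formula → Bool) : Prop :=
  (∀ α, e (neg α) = !(e α)) ∧ ∀ α β, e (Formula.and α β) = (e α && e β)

namespace IsBoolean

variable {e : Formula → Bool}

theorem apply_neg (he : IsBoolean e) (α : Formula) : e (neg α) = !(e α) := he.1 α

theorem apply_and (he : IsBoolean e) (α β : Formula) :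
    e (Formula.and α β) = (e α && e β) := he.2 α β

theorem apply_imp (he : IsBoolean e) (α β : Formula) : e (imp α β) = (!(e α) || e β) := by
  simp [imp, he.apply_neg, he.apply_and]

theorem apply_bot (he : IsBoolean e) : e bot = false := by
  simp [bot, he.apply_neg, he.apply_and]

theorem apply_conj (he : IsBoolean e) (l : List Formula) :
    e (conj l) = true ↔ ∀ φ ∈ l, e φ = true := by
  induction l with
  | nil => simp [conj, top, he.apply_neg, he.apply_bot]
  | cons φ l ih => simp [conj, he.apply_and, ih]

end IsBoolean

/-- Premises are moved one by one into implications until a tautology remains; modus ponens then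
discharges them. -/
theorem SigmaH.of_tautological_consequence {L : List Formula} (hL : ∀ ψ ∈ L, SigmaH ψ)
    {φ : Formula} (h : ∀ e, IsBoolean e → (∀ ψ ∈ L, e ψ = true) → e φ = true) : SigmaH φ := by
  induction L generalizing φ with
  | nil => exact .taut _ fun e h1 h2 => h e ⟨h1, h2⟩ (by simp)
  | cons ψ L ih =>
    refine .mp ψ φ (ih (fun χ hχ => hL χ (by simp [hχ])) fun e he hall => ?_) (hL ψ (by simp))
    rw [he.apply_imp]
    cases hψ : e ψ
    · rfl
    · simpa using h e he (by simpa [hψ] using hall)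

theorem SigmaH.imp_conj {l : List Formula} {φ : Formula}
    (h : ∀ e, IsBoolean e → (∀ ψ ∈ l, e ψ = true) → e φ = true) : SigmaH (imp (conj l) φ) := by
  refine .of_tautological_consequence (L := []) (by simp) fun e he _ => ?_
  rw [he.apply_imp]
  cases hl : e (conj l)
  · rfl
  · simpa using h e he ((he.apply_conj l).1 hl)

/-! ### Maximal consistent sets -/

theorem Consistent.mono {Γ Δ : Set Formula} (h : Γ ⊆ Δ) (hΔ : Consistent Δ) : Consistent Γ :=
  fun l hl => hΔ l fun φ hφ => h (hl φ hφ)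

theorem Consistent.sUnion {c : Set (Set Formula)} (hc : IsChain (· ⊆ ·) c) (hne : c.Nonempty)
    (h : ∀ Γ ∈ c, Consistent Γ) : Consistent (⋃₀ c) := by
  intro l hl
  have : ∃ Γ ∈ c, ∀ φ ∈ l, φ ∈ Γ := by
    induction l with
    | nil => exact hne.imp fun Γ hΓ => ⟨hΓ, by simp⟩
    | cons φ l ih =>
      obtain ⟨Γ, hΓ, hlΓ⟩ := ih fun ψ hψ => hl ψ (by simp [hψ])
      obtain ⟨Δ, hΔ, hφ⟩ := hl φ (by simp)
      rcases hc.total hΓ hΔ with hs | hs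
      · refine ⟨Δ, hΔ, fun ψ hψ => ?_⟩
        rcases List.mem_cons.1 hψ with rfl | hψ
        · exact hφ
        · exact hs (hlΓ ψ hψ)
      · refine ⟨Γ, hΓ, fun ψ hψ => ?_⟩
        rcases List.mem_cons.1 hψ with rfl | hψ
        · exact hs hφ
        · exact hlΓ ψ hψ
  obtain ⟨Γ, hΓ, hlΓ⟩ := this
  exact h Γ hΓ l hlΓ

/-- Maximal consistent sets of the full language. -/
abbrev IsMCS (Γ : Set Formula) : Prop := Γ ∈ atoms Set.univ

theorem Consistent.exists_isMCS {Γ : Set Formula} (h : Consistent Γ) : ∃ Δ, IsMCS Δ ∧ Γ ⊆ Δ := by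
  obtain ⟨Δ, hΓΔ, hΔ⟩ := zorn_subset_nonempty {Δ : Set Formula | Consistent Δ}
    (fun c hc hch hne => ⟨⋃₀ c, Consistent.sUnion hch hne fun _ hs => hc hs,
      fun _ => Set.subset_sUnion_of_mem⟩) Γ h
  exact ⟨Δ, ⟨⟨Set.subset_univ _, hΔ.1⟩, fun Θ hΘ hle => hΔ.2 hΘ.2 hle⟩, hΓΔ⟩

theorem Consistent.notMem_of_neg_mem {Γ : Set Formula} (h : Consistent Γ) {φ : Formula}
    (hn : neg φ ∈ Γ) : φ ∉ Γ := by
  intro hφ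
  refine h [φ, neg φ] (by simp [hφ, hn]) (SigmaH.imp_conj fun e he hl => ?_)
  simp [he.apply_neg] at hl

namespace IsMCS

variable {Γ : Set Formula}

theorem consistent (hΓ : IsMCS Γ) : Consistent Γ := hΓ.1.2

theorem exists_sigmaH_imp_neg (hΓ : IsMCS Γ) {φ : Formula} (h : φ ∉ Γ) :
    ∃ l : List Formula, (∀ ψ ∈ l, ψ ∈ Γ) ∧ SigmaH (imp (conj l) (neg φ)) := by
  classical
  have hc : ¬ Consistent (insert φ Γ) := fun hc =>
    h (hΓ.2 ⟨Set.subset_univ _, hc⟩ (Set.subset_insert _ _) (Set.mem_insert _ _))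
  simp only [Consistent, not_forall, not_not] at hc
  obtain ⟨l, hl, hbot⟩ := hc
  -- The formula φ may occur in `l` any number of times; filtering leaves only members of Γ.
  refine ⟨l.filter (· ≠ φ), fun ψ hψ => ?_, ?_⟩
  · simp only [List.mem_filter, decide_eq_true_eq] at hψ
    exact (hl ψ hψ.1).resolve_left hψ.2
  · refine .of_tautological_consequence (L := [imp (conj l) bot]) (by simpa using hbot)
      fun e he hall => ?_
    have h1 := hall _ (List.mem_singleton.2 rfl)
    rw [he.apply_imp, he.apply_bot, Bool.or_false, Bool.not_eq_true', ← Bool.not_eq_true,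
      he.apply_conj] at h1
    rw [he.apply_imp, he.apply_neg]
    cases h2 : e (conj (l.filter (· ≠ φ)))
    · rfl
    · cases h3 : e φ
      · rfl
      · rw [he.apply_conj] at h2
        refine absurd (fun ψ hψ => ?_) h1
        by_cases hψφ : ψ = φ
        · exact hψφ ▸ h3
        · exact h2 ψ (by simp [hψ, hψφ])

theorem mem_of_sigmaH_imp (hΓ : IsMCS Γ) {l : List Formula} (hl : ∀ ψ ∈ l, ψ ∈ Γ) {φ : Formula}
    (h : SigmaH (imp (conj l) φ)) : φ ∈ Γ := by
  by_contra hφ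
  obtain ⟨l', hl', h'⟩ := hΓ.exists_sigmaH_imp_neg hφ
  refine hΓ.consistent (l ++ l') (fun ψ hψ => (List.mem_append.1 hψ).elim (hl ψ) (hl' ψ)) ?_
  refine .of_tautological_consequence (L := [imp (conj l) φ, imp (conj l') (neg φ)])
    (by simp [h, h']) fun e he hall => ?_
  simp only [List.mem_cons, List.not_mem_nil, or_false, forall_eq_or_imp, forall_eq, he.apply_imp,
    he.apply_neg] at hall
  rw [he.apply_imp]
  cases h3 : e (conj (l ++ l'))
  · rfl
  · simp only [he.apply_conj, List.mem_append] at h3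
    rw [(he.apply_conj l).2 fun ψ hψ => h3 ψ (.inl hψ),
      (he.apply_conj l').2 fun ψ hψ => h3 ψ (.inr hψ)] at hall
    simp_all

theorem mem_of_tautological_consequence (hΓ : IsMCS Γ) {φ : Formula} (l : List Formula)
    (hl : ∀ ψ ∈ l, ψ ∈ Γ) (h : ∀ e, IsBoolean e → (∀ ψ ∈ l, e ψ = true) → e φ = true) : φ ∈ Γ :=
  hΓ.mem_of_sigmaH_imp hl (SigmaH.imp_conj h)

theorem mem_of_sigmaH (hΓ : IsMCS Γ) {φ : Formula} (h : SigmaH φ) : φ ∈ Γ := by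
  refine hΓ.mem_of_sigmaH_imp (l := []) (by simp) ?_
  refine .of_tautological_consequence (L := [φ]) (by simpa using h) fun e he hall => ?_
  simp [he.apply_imp, hall φ (by simp)]

theorem neg_mem_iff (hΓ : IsMCS Γ) {φ : Formula} : neg φ ∈ Γ ↔ φ ∉ Γ := by
  refine ⟨hΓ.consistent.notMem_of_neg_mem, fun h => ?_⟩
  obtain ⟨l, hl, hs⟩ := hΓ.exists_sigmaH_imp_neg h
  exact hΓ.mem_of_sigmaH_imp hl hs

theorem and_mem_iff (hΓ : IsMCS Γ) {φ ψ : Formula} : Formula.and φ ψ ∈ Γ ↔ φ ∈ Γ ∧ ψ ∈ Γ := by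
  refine ⟨fun h => ⟨?_, ?_⟩, fun h => ?_⟩
  · refine hΓ.mem_of_tautological_consequence [Formula.and φ ψ] (by simpa) fun e he hl => ?_
    simp_all [he.apply_and]
  · refine hΓ.mem_of_tautological_consequence [Formula.and φ ψ] (by simpa) fun e he hl => ?_
    simp_all [he.apply_and]
  · refine hΓ.mem_of_tautological_consequence [φ, ψ] (by simpa) fun e he hl => ?_
    simp_all [he.apply_and]

theorem imp_mem_iff (hΓ : IsMCS Γ) {φ ψ : Formula} : imp φ ψ ∈ Γ ↔ (φ ∈ Γ → ψ ∈ Γ) := by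
  simp [imp, hΓ.neg_mem_iff, hΓ.and_mem_iff]

theorem iff_mem_iff (hΓ : IsMCS Γ) {φ ψ : Formula} :
    Formula.iff φ ψ ∈ Γ ↔ (φ ∈ Γ ↔ ψ ∈ Γ) := by
  simp [Formula.iff, hΓ.and_mem_iff, hΓ.imp_mem_iff, iff_iff_implies_and_implies]

theorem bot_notMem (hΓ : IsMCS Γ) : bot ∉ Γ := by
  simp [bot, hΓ.and_mem_iff, hΓ.neg_mem_iff]

theorem top_mem (hΓ : IsMCS Γ) : top ∈ Γ := hΓ.neg_mem_iff.2 hΓ.bot_notMem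

end IsMCS

/-- Otherwise the negation is consistent and extends to a maximal consistent set. This turns
arguments about all maximal consistent sets into theorems, to which the rules `dis` and `arch`
apply. -/
theorem SigmaH.of_forall_isMCS {φ : Formula} (h : ∀ Γ, IsMCS Γ → φ ∈ Γ) : SigmaH φ := by
  by_contra hφ
  have hc : Consistent {neg φ} := by
    refine fun l hl hbot => hφ (.of_tautological_consequence (L := [imp (conj l) bot])
      (by simpa using hbot) fun e he hall => ?_)
    have h1 := hall _ (List.mem_singleton.2 rfl)
    by_contra hne
    rw [he.apply_imp, he.apply_bot, (he.apply_conj l).2 fun ψ hψ => ?_] at h1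
    · simp at h1
    · rw [Set.mem_singleton_iff.1 (hl ψ hψ), he.apply_neg]
      simpa using hne
  obtain ⟨Δ, hΔ, hsub⟩ := hc.exists_isMCS
  exact hΔ.neg_mem_iff.1 (hsub rfl) (h Δ hΔ)

/-- Closure under negation makes a trace on Λ maximal: whatever it omits is refuted inside Λ. Hence
all later arguments can use maximal consistent sets of the full language. -/
theorem atoms_eq_image {Λ : Set Formula} (hΛ : ∀ φ ∈ Λ, neg φ ∈ Λ) :
    atoms Λ = (· ∩ Λ) '' {Γ | IsMCS Γ} := by
  ext Γ
  constructor
  · intro hΓ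
    obtain ⟨Δ, hΔ, hsub⟩ := hΓ.1.2.exists_isMCS
    refine ⟨Δ, hΔ, Set.Subset.antisymm ?_ fun φ hφ => ⟨hsub hφ, hΓ.1.1 hφ⟩⟩
    exact hΓ.2 ⟨Set.inter_subset_right, hΔ.consistent.mono Set.inter_subset_left⟩
      fun φ hφ => ⟨hsub hφ, hΓ.1.1 hφ⟩
  · rintro ⟨Δ, hΔ, rfl⟩
    refine ⟨⟨Set.inter_subset_right, IsMCS.consistent hΔ |>.mono Set.inter_subset_left⟩, ?_⟩
    intro Θ hΘ hle φ hφ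
    refine ⟨?_, hΘ.1 hφ⟩
    by_contra hn
    exact hΘ.2.notMem_of_neg_mem (hle ⟨(IsMCS.neg_mem_iff hΔ).2 hn, hΛ φ (hΘ.1 hφ)⟩) hφ

/-! ### Probabilistic reasoning in maximal consistent sets -/

theorem SigmaH.bel_iff_of_forall {φ ψ : Formula} (h : ∀ Γ, IsMCS Γ → (φ ∈ Γ ↔ ψ ∈ Γ)) (r : Index) :
    SigmaH (Formula.iff (bel r φ) (bel r ψ)) :=
  .dis r φ ψ (.of_forall_isMCS fun Γ hΓ => hΓ.iff_mem_iff.2 (h Γ hΓ))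

namespace IsMCS

variable {Γ : Set Formula}

theorem bel_congr (hΓ : IsMCS Γ) {φ ψ : Formula} (h : ∀ Δ, IsMCS Δ → (φ ∈ Δ ↔ ψ ∈ Δ))
    (r : Index) : bel r φ ∈ Γ ↔ bel r ψ ∈ Γ :=
  hΓ.iff_mem_iff.1 (hΓ.mem_of_sigmaH (.bel_iff_of_forall h r))

theorem bel_zero_mem (hΓ : IsMCS Γ) (φ : Formula) : bel 0 φ ∈ Γ :=
  hΓ.mem_of_sigmaH (.A1 0 rfl φ)

theorem bel_mem_of_forall (hΓ : IsMCS Γ) {φ : Formula} (h : ∀ Δ, IsMCS Δ → φ ∈ Δ) (r : Index) :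
    bel r φ ∈ Γ :=
  (hΓ.bel_congr (fun Δ hΔ => by simp [h Δ hΔ, hΔ.top_mem]) r).2 (hΓ.mem_of_sigmaH (.A2 r))

theorem bel_add_mem (hΓ : IsMCS Γ) {r t s : Index} (hs : (s : ℚ) = r + t) {φ ψ : Formula}
    (h1 : bel r (Formula.and φ ψ) ∈ Γ) (h2 : bel t (Formula.and φ (neg ψ)) ∈ Γ) : bel s φ ∈ Γ :=
  hΓ.imp_mem_iff.1 (hΓ.mem_of_sigmaH (.A3 r t s hs φ ψ)) (hΓ.and_mem_iff.2 ⟨h1, h2⟩)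

theorem bel_add_notMem (hΓ : IsMCS Γ) {r t s : Index} (hs : (s : ℚ) = r + t) {φ ψ : Formula}
    (h1 : bel r (Formula.and φ ψ) ∉ Γ) (h2 : bel t (Formula.and φ (neg ψ)) ∉ Γ) :
    bel s φ ∉ Γ :=
  hΓ.neg_mem_iff.1 <| hΓ.imp_mem_iff.1 (hΓ.mem_of_sigmaH (.A4 r t s hs φ ψ))
    (hΓ.and_mem_iff.2 ⟨hΓ.neg_mem_iff.2 h1, hΓ.neg_mem_iff.2 h2⟩)

theorem bel_neg_notMem (hΓ : IsMCS Γ) {r s : Index} (hrs : (1 : ℚ) < r + s) {φ : Formula}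
    (h : bel r φ ∈ Γ) : bel s (neg φ) ∉ Γ :=
  hΓ.neg_mem_iff.1 (hΓ.imp_mem_iff.1 (hΓ.mem_of_sigmaH (.A5 r s hrs φ)) h)

/-- Split ψ along φ: the part inside φ carries weight r, the rest at least 0. -/
theorem bel_mono (hΓ : IsMCS Γ) {φ ψ : Formula} (h : ∀ Δ, IsMCS Δ → φ ∈ Δ → ψ ∈ Δ) {r : Index}
    (hr : bel r φ ∈ Γ) : bel r ψ ∈ Γ := by
  refine hΓ.bel_add_mem (r := r) (t := 0) (ψ := φ) (by simp) ?_ (hΓ.bel_zero_mem _)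
  refine (hΓ.bel_congr (fun Δ hΔ => ?_) r).1 hr
  rw [hΔ.and_mem_iff]
  exact ⟨fun hφ => ⟨h Δ hΔ hφ, hφ⟩, And.right⟩

theorem bel_notMem_of_forall (hΓ : IsMCS Γ) {φ : Formula} (h : ∀ Δ, IsMCS Δ → φ ∉ Δ) {r : Index}
    (hr : 0 < (r : ℚ)) : bel r φ ∉ Γ := by
  rw [hΓ.bel_congr (ψ := neg top) (fun Δ hΔ => by simp [h Δ hΔ, hΔ.neg_mem_iff, hΔ.top_mem]) r]
  exact hΓ.bel_neg_notMem (r := 1) (by simpa using hr) (hΓ.mem_of_sigmaH (.A2 1))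

/-- If ψ lacked weight s, so would φ ∧ ψ; and φ ∧ ¬ψ lacks the positive weight r - s because its
negation has probability one. By `A4`, φ then lacks weight r. The strict inequality in `A5` is what
costs the gap between s and r. -/
theorem bel_mem_of_lt (hΓ : IsMCS Γ) {φ ψ : Formula} {r s : Index} (hsr : s < r)
    (h : bel 1 (imp φ ψ) ∈ Γ) (hr : bel r φ ∈ Γ) : bel s ψ ∈ Γ := by
  by_contra hs
  have hlt : (s : ℚ) < r := hsr
  have hs0 := s.2.1
  have hr1 := r.2.2
  let t : Index := ⟨r - s, by linarith, by linarith⟩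
  refine hΓ.bel_add_notMem (r := s) (t := t) (s := r) (φ := φ) (ψ := ψ) (by simp [t])
    (fun h1 => hs (hΓ.bel_mono (fun Δ hΔ h2 => (hΔ.and_mem_iff.1 h2).2) h1)) ?_ hr
  rw [hΓ.bel_congr (ψ := neg (imp φ ψ)) fun Δ hΔ => by
    simp [hΔ.and_mem_iff, hΔ.neg_mem_iff, hΔ.imp_mem_iff]]
  exact hΓ.bel_neg_notMem (by simp [t, hlt]) h

/-- The infinitary rule closes the gap left by `bel_mem_of_lt`. It acts on theorems, not on members
of Γ, so both hypotheses are packed into its antecedent. -/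
theorem bel_mem_of_bel_one_imp (hΓ : IsMCS Γ) {φ ψ : Formula} {r : Index}
    (h : bel 1 (imp φ ψ) ∈ Γ) (hr : bel r φ ∈ Γ) : bel r ψ ∈ Γ := by
  have : SigmaH (imp (Formula.and (bel 1 (imp φ ψ)) (bel r φ)) (bel r ψ)) :=
    .arch r _ _ fun s hs => .of_forall_isMCS fun Δ hΔ => by
      rw [hΔ.imp_mem_iff, hΔ.and_mem_iff]
      exact fun ⟨h1, h2⟩ => hΔ.bel_mem_of_lt hs h1 h2
  exact hΓ.imp_mem_iff.1 (hΓ.mem_of_sigmaH this) (hΓ.and_mem_iff.2 ⟨h, hr⟩)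

theorem bel_anti (hΓ : IsMCS Γ) {φ : Formula} {r s : Index} (hsr : s ≤ r)
    (h : bel r φ ∈ Γ) : bel s φ ∈ Γ := by
  rcases hsr.eq_or_lt with rfl | hlt
  · exact h
  · exact hΓ.bel_mem_of_lt hlt
      (hΓ.bel_mem_of_forall (fun Δ hΔ => by simp [hΔ.imp_mem_iff]) 1) h

theorem bel_compl_mem (hΓ : IsMCS Γ) {φ : Formula} {r s : Index} (hrs : (r : ℚ) + s = 1)
    (h : bel r φ ∉ Γ) : bel s (neg φ) ∈ Γ := by
  by_contra hs
  refine hΓ.bel_add_notMem (r := r) (t := s) (s := 1) (φ := top) (ψ := φ) (by simp [hrs]) ?_ ?_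
    (hΓ.mem_of_sigmaH (.A2 1))
  · rwa [hΓ.bel_congr (ψ := φ) fun Δ hΔ => by simp [hΔ.and_mem_iff, hΔ.top_mem]]
  · rwa [hΓ.bel_congr (ψ := neg φ) fun Δ hΔ => by simp [hΔ.and_mem_iff, hΔ.top_mem]]

theorem bel_one_and_mem (hΓ : IsMCS Γ) {φ ψ : Formula} (h1 : bel 1 φ ∈ Γ) (h2 : bel 1 ψ ∈ Γ) :
    bel 1 (Formula.and φ ψ) ∈ Γ :=
  hΓ.bel_mem_of_bel_one_imp (hΓ.bel_mono (fun Δ hΔ => by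
    rw [hΔ.imp_mem_iff, hΔ.and_mem_iff]
    exact And.intro) h1) h2

theorem bel_one_bel_mem (hΓ : IsMCS Γ) {r : Index} {φ : Formula} (h : bel r φ ∈ Γ) :
    bel 1 (bel r φ) ∈ Γ :=
  hΓ.imp_mem_iff.1 (hΓ.mem_of_sigmaH (.four r 1 rfl φ)) h

theorem bel_one_neg_bel_mem (hΓ : IsMCS Γ) {r : Index} {φ : Formula} (h : bel r φ ∉ Γ) :
    bel 1 (neg (bel r φ)) ∈ Γ :=
  hΓ.imp_mem_iff.1 (hΓ.mem_of_sigmaH (.five r 1 rfl φ)) (hΓ.neg_mem_iff.2 h)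

theorem bel_congr_of_bel_one_iff (hΓ : IsMCS Γ) {φ ψ : Formula}
    (h : bel 1 (Formula.iff φ ψ) ∈ Γ) (r : Index) : bel r φ ∈ Γ ↔ bel r ψ ∈ Γ :=
  ⟨hΓ.bel_mem_of_bel_one_imp (hΓ.bel_mono (fun _ hΔ h => (hΔ.and_mem_iff.1 h).1) h),
    hΓ.bel_mem_of_bel_one_imp (hΓ.bel_mono (fun _ hΔ h => (hΔ.and_mem_iff.1 h).2) h)⟩

end IsMCS

/-! ### Eliminating nested modalities -/

open Classical in
/-- The modality-free formula obtained from a formula by replacing its outermost subformulas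
`bel r φ` with a verum or falsum in the letter `n`, according to their membership in `Γ`. -/
noncomputable def flatten (Γ : Set Formula) (n : ℕ) : Formula → Formula
  | letter m => letter m
  | neg φ => neg (flatten Γ n φ)
  | Formula.and φ ψ => Formula.and (flatten Γ n φ) (flatten Γ n ψ)
  | bel r φ =>
    -- `bot` is built from `letter 0`, which may lie outside the language; a letter `n` of the
    -- language serves instead.
    if bel r φ ∈ Γ then neg (Formula.and (letter n) (neg (letter n)))
    else Formula.and (letter n) (neg (letter n))

/-- In the modal case positive or negative introspection settles the formula with probability one.
Nothing is needed about its argument, since the whole modal subformula is replaced. -/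
theorem IsMCS.bel_one_iff_flatten_mem {Γ : Set Formula} (hΓ : IsMCS Γ) (n : ℕ) (φ : Formula) :
    bel 1 (Formula.iff φ (flatten Γ n φ)) ∈ Γ := by
  induction φ with
  | letter m => exact hΓ.bel_mem_of_forall (fun Δ hΔ => by simp [flatten, hΔ.iff_mem_iff]) 1
  | neg φ ih =>
    refine hΓ.bel_mono (fun Δ hΔ h => ?_) ih
    rw [hΔ.iff_mem_iff] at h
    rw [flatten, hΔ.iff_mem_iff, hΔ.neg_mem_iff, hΔ.neg_mem_iff, h]
  | and φ ψ ih1 ih2 =>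
    refine hΓ.bel_mono (fun Δ hΔ h => ?_) (hΓ.bel_one_and_mem ih1 ih2)
    rw [hΔ.and_mem_iff, hΔ.iff_mem_iff, hΔ.iff_mem_iff] at h
    rw [flatten, hΔ.iff_mem_iff, hΔ.and_mem_iff, hΔ.and_mem_iff, h.1, h.2]
  | bel r φ ih =>
    by_cases hb : bel r φ ∈ Γ
    · refine hΓ.bel_mono (fun Δ hΔ h => ?_) (hΓ.bel_one_bel_mem hb)
      simp [flatten, hb, hΔ.iff_mem_iff, hΔ.neg_mem_iff, hΔ.and_mem_iff, h]
    · refine hΓ.bel_mono (fun Δ hΔ h => ?_) (hΓ.bel_one_neg_bel_mem hb)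
      rw [hΔ.neg_mem_iff] at h
      simp [flatten, hb, hΔ.iff_mem_iff, hΔ.neg_mem_iff, hΔ.and_mem_iff, h]

theorem depth_flatten (Γ : Set Formula) (n : ℕ) (φ : Formula) : depth (flatten Γ n φ) = 0 := by
  induction φ with
  | letter m => rfl
  | neg φ ih => simpa [flatten, depth] using ih
  | and φ ψ ih1 ih2 => simp [flatten, depth, ih1, ih2]
  | bel r φ ih => by_cases h : bel r φ ∈ Γ <;> simp [flatten, depth, h]

theorem over_flatten {I : Set Index} {P : Set ℕ} (Γ : Set Formula) {n : ℕ} (hn : n ∈ P)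
    {φ : Formula} (hφ : Over I P φ) : Over I P (flatten Γ n φ) := by
  induction φ with
  | letter m => exact hφ
  | neg φ ih => exact ih hφ
  | and φ ψ ih1 ih2 => exact ⟨ih1 hφ.1, ih2 hφ.2⟩
  | bel r φ ih => by_cases h : bel r φ ∈ Γ <;> simp [flatten, Over, h, hn]

theorem flatten_congr {I : Set Index} {P : Set ℕ} {Γ Δ : Set Formula} (n : ℕ) {φ : Formula}
    (hφ : Over I P φ)
    (h : ∀ ψ, depth ψ ≤ depth φ → Over I P ψ → (ψ ∈ Γ ↔ ψ ∈ Δ)) :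
    flatten Γ n φ = flatten Δ n φ := by
  induction φ with
  | letter m => rfl
  | neg φ ih => exact congrArg neg (ih hφ h)
  | and φ ψ ih1 ih2 =>
    exact congrArg₂ Formula.and
      (ih1 hφ.1 fun χ hχ => h χ (hχ.trans (le_max_left _ _)))
      (ih2 hφ.2 fun χ hχ => h χ (hχ.trans (le_max_right _ _)))
  | bel r φ ih =>
    by_cases hΔ : bel r φ ∈ Δ
    · simp [flatten, hΔ, (h (bel r φ) le_rfl hφ).2 hΔ]
    · simp [flatten, hΔ, mt (h (bel r φ) le_rfl hφ).1 hΔ]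

/-- Formulas have no primitive constants, so each contains a letter; this supplies the `n` for
`flatten`. -/
theorem Formula.Over.nonempty {I : Set Index} {P : Set ℕ} {φ : Formula} (h : Over I P φ) :
    P.Nonempty := by
  induction φ with
  | letter n => exact ⟨n, h⟩
  | neg φ ih => exact ih h
  | and φ ψ ih1 ih2 => exact ih1 h.1
  | bel r φ ih => exact ih h.2

/-- Maximal consistent sets that agree on the formulas of depth at most one agree on the
formulas of every depth. -/
theorem IsMCS.mem_iff_of_agree {I : Set Index} {P : Set ℕ} {Γ Δ : Set Formula} (hΓ : IsMCS Γ)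
    (hΔ : IsMCS Δ) (h : ∀ φ, Over I P φ → depth φ ≤ 1 → (φ ∈ Γ ↔ φ ∈ Δ)) {φ : Formula}
    (hφ : Over I P φ) : φ ∈ Γ ↔ φ ∈ Δ := by
  obtain ⟨n, hn⟩ := hφ.nonempty
  suffices H : ∀ d φ, depth φ ≤ d → Over I P φ → (φ ∈ Γ ↔ φ ∈ Δ) from H _ φ le_rfl hφ
  intro d
  induction d with
  | zero => exact fun φ hd hφ => h φ hφ (hd.trans zero_le_one)
  | succ d ih =>
    intro φ
    induction φ with
    | letter m => exact fun _ hφ => h _ hφ zero_le_one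
    | neg φ ih' => exact fun hd hφ => by rw [hΓ.neg_mem_iff, hΔ.neg_mem_iff, ih' hd hφ]
    | and φ ψ ih1 ih2 =>
      intro hd hφ
      rw [hΓ.and_mem_iff, hΔ.and_mem_iff, ih1 ((le_max_left _ _).trans hd) hφ.1,
        ih2 ((le_max_right _ _).trans hd) hφ.2]
    | bel r φ _ =>
      intro hd hφ
      have hd' : depth φ ≤ d := Nat.le_of_succ_le_succ hd
      -- By the induction hypothesis on depth both sets flatten φ to the same formula, so only a
      -- depth-one formula remains to be compared.
      rw [hΓ.bel_congr_of_bel_one_iff (hΓ.bel_one_iff_flatten_mem n φ),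
        hΔ.bel_congr_of_bel_one_iff (hΔ.bel_one_iff_flatten_mem n φ),
        flatten_congr (Δ := Δ) n hφ.2 fun ψ hψ => ih ψ (hψ.trans hd')]
      exact h _ ⟨hφ.1, over_flatten Δ hn hφ.2⟩ (by simp [depth, depth_flatten])

/-! ### Truth tables and finiteness -/

/-- Truth of a formula when exactly the letters in `A` are true; modal formulas count as false. -/
def Holds (A : Set ℕ) : Formula → Prop
  | letter n => n ∈ A
  | neg φ => ¬ Holds A φ
  | Formula.and φ ψ => Holds A φ ∧ Holds A ψ
  | bel _ _ => False

theorem IsMCS.mem_iff_holds {Γ : Set Formula} (hΓ : IsMCS Γ) {I : Set Index} {P : Set ℕ}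
    {φ : Formula} (hφ : Over I P φ) (hd : depth φ = 0) :
    φ ∈ Γ ↔ Holds {n | n ∈ P ∧ letter n ∈ Γ} φ := by
  induction φ with
  | letter n => exact (and_iff_right hφ).symm
  | neg φ ih => rw [hΓ.neg_mem_iff, Holds, ih hφ hd]
  | and φ ψ ih1 ih2 =>
    simp only [depth, Nat.max_eq_zero_iff] at hd
    rw [hΓ.and_mem_iff, Holds, ih1 hφ.1 hd.1, ih2 hφ.2 hd.2]
  | bel r φ _ => simp [depth] at hd

/-- The truth table of a modality-free formula over the letters in `P`. -/
def truthTable (P : Set ℕ) (φ : Formula) : Set (Set ℕ) := {A | A ⊆ P ∧ Holds A φ}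

theorem IsMCS.mem_iff_of_truthTable_eq {Γ : Set Formula} (hΓ : IsMCS Γ) {I : Set Index} {P : Set ℕ}
    {φ ψ : Formula} (hφ : Over I P φ) (hφ0 : depth φ = 0) (hψ : Over I P ψ) (hψ0 : depth ψ = 0)
    (h : truthTable P φ = truthTable P ψ) : φ ∈ Γ ↔ ψ ∈ Γ := by
  have hsub : {n | n ∈ P ∧ letter n ∈ Γ} ⊆ P := fun n hn => hn.1
  rw [hΓ.mem_iff_holds hφ hφ0, hΓ.mem_iff_holds hψ hψ0]
  simpa [truthTable, hsub] using Set.ext_iff.1 h {n | n ∈ P ∧ letter n ∈ Γ}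

/-- The letters in a set of formulas, and the indices and truth tables of its members of the
form `bel r φ` with `φ` modality-free. -/
def code (I : Set Index) (P : Set ℕ) (Γ : Set Formula) : Set ℕ × Set (Index × Set (Set ℕ)) :=
  ({n | n ∈ P ∧ letter n ∈ Γ},
    {x | ∃ φ, Over I P (bel x.1 φ) ∧ depth φ = 0 ∧ x.2 = truthTable P φ ∧ bel x.1 φ ∈ Γ})

theorem finite_image_code {I : Set Index} {P : Set ℕ} (hI : I.Finite) (hP : P.Finite)
    (S : Set (Set Formula)) : (code I P '' S).Finite := by
  refine (hP.powerset.prod (hI.prod hP.powerset.powerset).powerset).subset ?_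
  rintro _ ⟨Γ, -, rfl⟩
  refine ⟨fun n hn => hn.1, ?_⟩
  rintro ⟨r, t⟩ ⟨φ, hφ, -, ht, -⟩
  refine ⟨hφ.1, ?_⟩
  simp only at ht
  subst ht
  exact fun A hA => hA.1

theorem IsMCS.mem_iff_of_code_eq {I : Set Index} {P : Set ℕ} {Γ Δ : Set Formula} (hΓ : IsMCS Γ)
    (hΔ : IsMCS Δ) (h : code I P (Γ ∩ language I P) = code I P (Δ ∩ language I P))
    {φ : Formula} (hφ : Over I P φ) : φ ∈ Γ ↔ φ ∈ Δ := by
  obtain ⟨h1, h2⟩ := Prod.ext_iff.1 h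
  refine hΓ.mem_iff_of_agree hΔ (fun φ hφ hd => ?_) hφ
  induction φ with
  | letter n =>
    have hn : n ∈ P := hφ
    simpa [code, language, Over, hn] using Set.ext_iff.1 h1 n
  | neg φ ih => rw [hΓ.neg_mem_iff, hΔ.neg_mem_iff, ih hφ hd]
  | and φ ψ ih1 ih2 =>
    rw [hΓ.and_mem_iff, hΔ.and_mem_iff, ih1 hφ.1 ((le_max_left _ _).trans hd),
      ih2 hφ.2 ((le_max_right _ _).trans hd)]
  | bel r φ _ =>
    have hd0 : depth φ = 0 := by simpa [depth] using hd
    -- The formula recorded in the code may differ from φ, but it has the same truth table, and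
    -- `bel_congr` transfers the belief.
    have key : ∀ Θ, IsMCS Θ →
        (bel r φ ∈ Θ ↔ (r, truthTable P φ) ∈ (code I P (Θ ∩ language I P)).2) := by
      refine fun Θ hΘ => ⟨fun hb => ⟨φ, hφ, hd0, rfl, hb, hφ⟩, ?_⟩
      rintro ⟨ψ, hψ, hψ0, ht, hb, -⟩
      exact (hΘ.bel_congr (fun Ξ hΞ => hΞ.mem_iff_of_truthTable_eq hφ.2 hd0 hψ.2 hψ0 ht) r).2 hb
    rw [key Γ hΓ, key Δ hΔ, h2]

theorem canonicalSpace_eq_image (I : Set Index) (P : Set ℕ) :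
    canonicalSpace I P = (· ∩ language I P) '' {Γ | IsMCS Γ} :=
  atoms_eq_image fun _ h => h

theorem omegaH_eq_image (q d w : ℕ) :
    OmegaH q d w = (· ∩ localLanguage q d w) '' {Γ | IsMCS Γ} :=
  atoms_eq_image fun _ h => h

theorem finite_canonicalSpace {I : Set Index} {P : Set ℕ} (hI : I.Finite) (hP : P.Finite) :
    (canonicalSpace I P).Finite := by
  refine Set.Finite.of_finite_image (finite_image_code hI hP _) ?_
  rw [canonicalSpace_eq_image]
  rintro _ ⟨Γ, hΓ, rfl⟩ _ ⟨Δ, hΔ, rfl⟩ h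
  ext φ
  exact and_congr_left fun hφ => IsMCS.mem_iff_of_code_eq hΓ hΔ h hφ

/-! ### Local languages: finiteness and stabilization in depth -/

/-- The index `k / q`, truncated at one. -/
def gridIndex (q k : ℕ) : Index :=
  ⟨((min k q : ℕ) : ℚ) / q, by positivity,
    div_le_one_of_le₀ (by exact_mod_cast min_le_right k q) (by positivity)⟩

theorem coe_gridIndex {q k : ℕ} (hk : k ≤ q) : (gridIndex q k : ℚ) = k / q := by
  simp [gridIndex, hk]

theorem exists_eq_gridIndex {q : ℕ} (hq : 1 ≤ q) {r : Index} (hr : r ∈ multiples q) :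
    ∃ k ≤ q, r = gridIndex q k := by
  obtain ⟨k, hk⟩ := hr
  have hq' : (0 : ℚ) < q := by exact_mod_cast hq
  have hkq : k ≤ q := by
    have := r.2.2
    rw [hk, div_le_one hq'] at this
    exact_mod_cast this
  exact ⟨k, hkq, Subtype.ext (hk.trans (coe_gridIndex hkq).symm)⟩

theorem gridIndex_mem_multiples (q k : ℕ) : gridIndex q k ∈ multiples q := ⟨min k q, rfl⟩

theorem finite_multiples {q : ℕ} (hq : 1 ≤ q) : (multiples q).Finite := by
  refine ((Set.finite_Iic q).image (gridIndex q)).subset fun r hr => ?_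
  obtain ⟨k, hk, rfl⟩ := exists_eq_gridIndex hq hr
  exact ⟨k, hk, rfl⟩

theorem finite_omegaH {q : ℕ} (hq : 1 ≤ q) (d w : ℕ) : (OmegaH q d w).Finite := by
  have h := (finite_canonicalSpace (finite_multiples hq) (Set.finite_lt_nat w)).image
    (· ∩ localLanguage q d w)
  rw [canonicalSpace_eq_image, Set.image_image] at h
  refine h.subset ?_
  rw [omegaH_eq_image]
  rintro _ ⟨Γ, hΓ, rfl⟩
  refine ⟨Γ, hΓ, ?_⟩
  ext φ
  exact ⟨fun h => ⟨h.1.1, h.2⟩, fun h => ⟨⟨h.1, h.2.1⟩, h.2⟩⟩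

/-- Restriction to depth `d` is onto because both sides are traces of full maximal consistent sets;
it is injective because `d ≥ 1` keeps all formulas of depth at most one. -/
theorem ncard_omegaH_add (q w k : ℕ) {d : ℕ} (hd : 1 ≤ d) :
    (OmegaH q d w).ncard = (OmegaH q (d + k) w).ncard := by
  have himage : OmegaH q d w = (· ∩ localLanguage q d w) '' OmegaH q (d + k) w := by
    rw [omegaH_eq_image, omegaH_eq_image, Set.image_image]
    refine Set.image_congr fun Γ _ => ?_
    ext φ
    exact ⟨fun h => ⟨⟨h.1, h.2.1, h.2.2.trans (Nat.le_add_right d k)⟩, h.2⟩,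
      fun h => ⟨h.1.1, h.2⟩⟩
  rw [himage]
  refine Set.InjOn.ncard_image ?_
  rw [omegaH_eq_image]
  rintro _ ⟨Γ, hΓ, rfl⟩ _ ⟨Δ, hΔ, rfl⟩ h
  ext φ
  refine and_congr_left fun hφ => IsMCS.mem_iff_of_agree hΓ hΔ (fun ψ hψ hψd => ?_) hφ.1
  have hψΛ : ψ ∈ localLanguage q d w := ⟨hψ, hψd.trans hd⟩
  have hψΛ' : ψ ∈ localLanguage q (d + k) w := ⟨hψ, hψd.trans (hd.trans (Nat.le_add_right d k))⟩
  simpa [hψΛ, hψΛ'] using Set.ext_iff.1 h ψ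

/-! ### Soundness in two-state models -/

/-- The measure of `A` on the two-point space `Bool` where `true` has mass `x` and `false` has
mass `1 - x`. -/
def boolMeasure (x : ℚ) (A : Bool → Bool) : ℚ :=
  (if A true then x else 0) + (if A false then 1 - x else 0)

/-- Truth in the two-state type space in which both states carry the belief `boolMeasure x`. -/
def sat (x : ℚ) (V : ℕ → Bool → Bool) : Formula → Bool → Bool
  | letter n, b => V n b
  | neg φ, b => !(sat x V φ b)
  | Formula.and φ ψ, b => sat x V φ b && sat x V ψ b
  | bel r φ, _ => decide ((r : ℚ) ≤ boolMeasure x (sat x V φ))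

theorem sat_subst (x : ℚ) (V : ℕ → Bool → Bool) (σ : ℕ → Formula) (φ : Formula) :
    sat x V (subst σ φ) = sat x (fun n => sat x V (σ n)) φ := by
  induction φ with
  | letter n => rfl
  | neg φ ih => funext b; simp [subst, sat, ih]
  | and φ ψ ih1 ih2 => funext b; simp [subst, sat, ih1, ih2]
  | bel r φ ih => funext b; simp [subst, sat, ih]

theorem isBoolean_sat (x : ℚ) (V : ℕ → Bool → Bool) (b : Bool) :
    IsBoolean fun φ => sat x V φ b := ⟨fun _ => rfl, fun _ _ => rfl⟩

theorem boolMeasure_nonneg {x : ℚ} (h0 : 0 ≤ x) (h1 : x ≤ 1) (A : Bool → Bool) :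
    0 ≤ boolMeasure x A := by
  unfold boolMeasure
  split_ifs <;> linarith

theorem boolMeasure_not (x : ℚ) (A : Bool → Bool) :
    boolMeasure x (fun b => !(A b)) = 1 - boolMeasure x A := by
  unfold boolMeasure
  cases h1 : A true <;> cases h2 : A false <;> simp [h1, h2]

theorem boolMeasure_eq_add (x : ℚ) (A B : Bool → Bool) :
    boolMeasure x A =
      boolMeasure x (fun b => A b && B b) + boolMeasure x (fun b => A b && !(B b)) := by
  unfold boolMeasure
  cases h1 : A true <;> cases h2 : A false <;> cases h3 : B true <;> cases h4 : B false <;>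
    simp [h1, h2, h3, h4]

theorem boolMeasure_const (x : ℚ) (c : Bool) :
    boolMeasure x (fun _ => c) = if c then 1 else 0 := by
  unfold boolMeasure
  cases c <;> simp

theorem sat_imp_iff {x : ℚ} {V : ℕ → Bool → Bool} {b : Bool} {φ ψ : Formula} :
    sat x V (imp φ ψ) b = true ↔ (sat x V φ b = true → sat x V ψ b = true) := by
  rw [(isBoolean_sat x V b).apply_imp]
  cases sat x V φ b <;> simp

theorem sat_neg_iff {x : ℚ} {V : ℕ → Bool → Bool} {b : Bool} {φ : Formula} :
    sat x V (neg φ) b = true ↔ ¬ sat x V φ b = true := by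
  simp [sat]

theorem sat_and_iff {x : ℚ} {V : ℕ → Bool → Bool} {b : Bool} {φ ψ : Formula} :
    sat x V (Formula.and φ ψ) b = true ↔ sat x V φ b = true ∧ sat x V ψ b = true := by
  simp [sat]

theorem sat_bel_iff {x : ℚ} {V : ℕ → Bool → Bool} {b : Bool} {r : Index} {φ : Formula} :
    sat x V (bel r φ) b = true ↔ (r : ℚ) ≤ boolMeasure x (sat x V φ) := by
  simp [sat]

/-- Both states share one belief, so belief formulas denote the empty or the full event; this
validates introspection. The induction varies `V` because substitution changes the valuation, and
`b` because `dis` needs equality of events. -/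
theorem SigmaH.sound {x : ℚ} (h0 : 0 ≤ x) (h1 : x ≤ 1) {φ : Formula} (h : SigmaH φ)
    (V : ℕ → Bool → Bool) (b : Bool) : sat x V φ b = true := by
  induction h generalizing V b with
  | taut φ h => exact h (fun φ => sat x V φ b) (fun _ => rfl) (fun _ _ => rfl)
  | A1 r hr φ => simpa [sat, hr] using boolMeasure_nonneg h0 h1 _
  | A2 r =>
    have : sat x V top = fun _ => true := by funext b; simp [top, bot, sat]
    simpa [sat, this, boolMeasure_const] using r.2.2
  | A3 r t s hs φ ψ =>
    have hadd := boolMeasure_eq_add x (sat x V φ) (sat x V ψ)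
    rw [sat_imp_iff, sat_and_iff, sat_bel_iff, sat_bel_iff, sat_bel_iff]
    rintro ⟨h2, h3⟩
    change (r : ℚ) ≤ boolMeasure x (fun b => sat x V φ b && sat x V ψ b) at h2
    change (t : ℚ) ≤ boolMeasure x (fun b => sat x V φ b && !(sat x V ψ b)) at h3
    linarith
  | A4 r t s hs φ ψ =>
    have hadd := boolMeasure_eq_add x (sat x V φ) (sat x V ψ)
    rw [sat_imp_iff, sat_and_iff, sat_neg_iff, sat_neg_iff, sat_neg_iff, sat_bel_iff, sat_bel_iff,
      sat_bel_iff]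
    rintro ⟨h2, h3⟩
    change ¬ (r : ℚ) ≤ boolMeasure x (fun b => sat x V φ b && sat x V ψ b) at h2
    change ¬ (t : ℚ) ≤ boolMeasure x (fun b => sat x V φ b && !(sat x V ψ b)) at h3
    linarith
  | A5 r s hrs φ =>
    have hnot := boolMeasure_not x (sat x V φ)
    rw [sat_imp_iff, sat_neg_iff, sat_bel_iff, sat_bel_iff]
    intro h2
    change ¬ (s : ℚ) ≤ boolMeasure x (fun b => !(sat x V φ b))
    linarith
  | four r one h1 φ =>
    rw [sat_imp_iff, sat_bel_iff, sat_bel_iff]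
    intro h2
    change (one : ℚ) ≤ boolMeasure x (fun _ => decide ((r : ℚ) ≤ boolMeasure x (sat x V φ)))
    simp [boolMeasure_const, h2, h1]
  | five r one h1 φ =>
    rw [sat_imp_iff, sat_neg_iff, sat_bel_iff, sat_bel_iff]
    intro h2
    change (one : ℚ) ≤ boolMeasure x (fun _ => !decide ((r : ℚ) ≤ boolMeasure x (sat x V φ)))
    rw [boolMeasure_const]
    simp [h2, h1]
  | mp φ ψ _ _ ih1 ih2 => exact sat_imp_iff.1 (ih1 V b) (ih2 V b)
  | unifSubst σ φ _ ih => rw [sat_subst]; exact ih _ b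
  | dis r φ ψ _ ih =>
    have hφψ : sat x V φ = sat x V ψ := by
      funext b
      have hb := ih V b
      rw [Formula.iff, sat_and_iff, sat_imp_iff, sat_imp_iff] at hb
      exact Bool.eq_iff_iff.2 ⟨hb.1, hb.2⟩
    rw [Formula.iff, sat_and_iff, sat_imp_iff, sat_imp_iff, sat_bel_iff, sat_bel_iff, hφψ]
    exact ⟨id, id⟩
  | arch r γ φ _ ih =>
    rw [sat_imp_iff, sat_bel_iff]
    intro hγ
    -- Indices are dense below r, so the bounds at all smaller indices give the bound at r; negative
    -- `s` are not indices and need separate treatment.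
    refine le_of_forall_lt fun s hs => ?_
    rcases lt_or_ge s 0 with hs0 | hs0
    · exact hs0.trans_le (boolMeasure_nonneg h0 h1 _)
    · obtain ⟨t, hst, htr⟩ := exists_between hs
      exact hst.trans_le (sat_bel_iff.1 (sat_imp_iff.1
        (ih ⟨t, hs0.trans hst.le, htr.le.trans r.2.2⟩ htr V b) hγ))

/-- The formulas true in the state `b` of the two-state type space in which the letters are true
exactly in the state `true`. -/
def stateTheory (x : ℚ) (b : Bool) : Set Formula := {φ | sat x (fun _ b => b) φ b = true}

/-- Soundness gives consistency; maximality holds because each formula or its negation is true at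
the state. -/
theorem isMCS_stateTheory {x : ℚ} (h0 : 0 ≤ x) (h1 : x ≤ 1) (b : Bool) :
    IsMCS (stateTheory x b) := by
  have hb := isBoolean_sat x (fun _ b => b) b
  refine ⟨⟨Set.subset_univ _, fun l hl hbot => ?_⟩, fun Δ hΔ hle φ hφ => ?_⟩
  · have := hbot.sound h0 h1 (fun _ b => b) b
    rw [hb.apply_imp, hb.apply_bot, (hb.apply_conj l).2 hl] at this
    simp at this
  · by_contra hn
    have hneg : neg φ ∈ stateTheory x b := by
      exact sat_neg_iff.2 hn
    exact hΔ.2.notMem_of_neg_mem (hle hneg) hφ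

theorem letter_mem_stateTheory {x : ℚ} {b : Bool} {n : ℕ} :
    letter n ∈ stateTheory x b ↔ b = true := Iff.rfl

theorem bel_letter_mem_stateTheory {x : ℚ} {b : Bool} {r : Index} {n : ℕ} :
    bel r (letter n) ∈ stateTheory x b ↔ (r : ℚ) ≤ x := by
  simp [stateTheory, sat, boolMeasure]

theorem bel_neg_letter_mem_stateTheory {x : ℚ} {b : Bool} {r : Index} {n : ℕ} :
    bel r (neg (letter n)) ∈ stateTheory x b ↔ (r : ℚ) ≤ 1 - x := by
  simp [stateTheory, sat, boolMeasure]

/-! ### Counting atoms with one letter -/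

theorem IsMCS.mem_iff_holds_of_single_letter {Γ : Set Formula} (hΓ : IsMCS Γ) {I : Set Index}
    {φ : Formula} (hφ : Over I {n | n < 1} φ) (hd : depth φ = 0) :
    φ ∈ Γ ↔ (letter 0 ∈ Γ ∧ Holds {0} φ) ∨ (letter 0 ∉ Γ ∧ Holds ∅ φ) := by
  rw [hΓ.mem_iff_holds hφ hd]
  by_cases h : letter 0 ∈ Γ
  · have hA : {n | n ∈ {n : ℕ | n < 1} ∧ letter n ∈ Γ} = {0} := by
      ext n
      exact ⟨fun hn => Nat.lt_one_iff.1 hn.1, by rintro rfl; exact ⟨Nat.one_pos, h⟩⟩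
    rw [hA]
    simp [h]
  · have hA : {n | n ∈ {n : ℕ | n < 1} ∧ letter n ∈ Γ} = ∅ := by
      refine Set.eq_empty_of_forall_notMem fun n hn => h ?_
      obtain rfl : n = 0 := Nat.lt_one_iff.1 hn.1
      exact hn.2
    rw [hA]
    simp [h]

/-- In a language with one letter, a maximal consistent set is determined by the letter and the
probability bounds on it and on its negation. -/
theorem IsMCS.mem_iff_of_single_letter {Γ Δ : Set Formula} (hΓ : IsMCS Γ) (hΔ : IsMCS Δ)
    {I : Set Index} (hl : letter 0 ∈ Γ ↔ letter 0 ∈ Δ)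
    (hpos : ∀ r ∈ I, bel r (letter 0) ∈ Γ ↔ bel r (letter 0) ∈ Δ)
    (hneg : ∀ r ∈ I, bel r (neg (letter 0)) ∈ Γ ↔ bel r (neg (letter 0)) ∈ Δ)
    {φ : Formula} (hφ : Over I {n | n < 1} φ) : φ ∈ Γ ↔ φ ∈ Δ := by
  refine hΓ.mem_iff_of_agree hΔ (fun φ hφ hd => ?_) hφ
  induction φ with
  | letter n =>
    obtain rfl : n = 0 := Nat.lt_one_iff.1 hφ
    exact hl
  | neg φ ih => rw [hΓ.neg_mem_iff, hΔ.neg_mem_iff, ih hφ hd]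
  | and φ ψ ih1 ih2 =>
    rw [hΓ.and_mem_iff, hΔ.and_mem_iff, ih1 hφ.1 ((le_max_left _ _).trans hd),
      ih2 hφ.2 ((le_max_right _ _).trans hd)]
  | bel r φ _ =>
    have hd0 : depth φ = 0 := by simpa [depth] using hd
    have key := fun Θ (hΘ : IsMCS Θ) => hΘ.mem_iff_holds_of_single_letter hφ.2 hd0
    -- The four cases are, in order, φ equivalent to ⊤, p, ¬p and ⊥. For ⊥ the index 0 is
    -- exceptional.
    by_cases h1 : Holds {0} φ <;> by_cases h2 : Holds ∅ φ <;>
      simp only [h1, h2, and_true, and_false, or_false, false_or, em] at key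
    · exact iff_of_true (hΓ.bel_mem_of_forall (fun Θ hΘ => (key Θ hΘ).2 trivial) r)
        (hΔ.bel_mem_of_forall (fun Θ hΘ => (key Θ hΘ).2 trivial) r)
    · rw [hΓ.bel_congr key, hΔ.bel_congr key, hpos r hφ.1]
    · have key' : ∀ Θ, IsMCS Θ → (φ ∈ Θ ↔ neg (letter 0) ∈ Θ) :=
        fun Θ hΘ => (key Θ hΘ).trans hΘ.neg_mem_iff.symm
      rw [hΓ.bel_congr key', hΔ.bel_congr key', hneg r hφ.1]
    · rcases eq_or_lt_of_le r.2.1 with h0 | h0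
      · obtain rfl : (0 : Index) = r := Subtype.ext h0
        exact iff_of_true (hΓ.bel_zero_mem φ) (hΔ.bel_zero_mem φ)
      · exact iff_of_false (hΓ.bel_notMem_of_forall (fun Θ hΘ => (key Θ hΘ).1) h0)
          (hΔ.bel_notMem_of_forall (fun Θ hΘ => (key Θ hΘ).1) h0)

/-- The believed grid indices form an initial segment by `bel_anti`, nonempty because of index 0. -/
theorem IsMCS.exists_threshold {Γ : Set Formula} (hΓ : IsMCS Γ) (q : ℕ) (φ : Formula) :
    ∃ a ≤ q, ∀ k ≤ q, bel (gridIndex q k) φ ∈ Γ ↔ k ≤ a := by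
  classical
  refine ⟨Nat.findGreatest (fun k => bel (gridIndex q k) φ ∈ Γ) q, Nat.findGreatest_le q,
    fun k hk => ⟨fun h => Nat.le_findGreatest hk h, fun hka => ?_⟩⟩
  have h0 : bel (gridIndex q 0) φ ∈ Γ := hΓ.mem_of_sigmaH (.A1 _ (by simp [gridIndex]) φ)
  refine hΓ.bel_anti ?_ (Nat.findGreatest_spec (P := fun k => bel (gridIndex q k) φ ∈ Γ)
    (Nat.zero_le q) h0)
  rw [← Subtype.coe_le_coe, coe_gridIndex hk, coe_gridIndex (Nat.findGreatest_le q)]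
  gcongr

theorem gridIndex_le_div_iff {q k c : ℕ} (hq : 1 ≤ q) (hk : k ≤ q) :
    (gridIndex q k : ℚ) ≤ c / (2 * q) ↔ 2 * k ≤ c := by
  have hq' : (0 : ℚ) < q := by exact_mod_cast hq
  rw [coe_gridIndex hk, div_le_div_iff₀ hq' (by positivity), ← mul_assoc, mul_comm (k : ℚ) 2,
    mul_le_mul_iff_left₀ hq']
  exact_mod_cast Iff.rfl

theorem gridIndex_le_one_sub_div_iff {q k c : ℕ} (hq : 1 ≤ q) (hk : k ≤ q) :
    (gridIndex q k : ℚ) ≤ 1 - c / (2 * q) ↔ 2 * k + c ≤ 2 * q := by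
  have hq' : (0 : ℚ) < q := by exact_mod_cast hq
  rw [coe_gridIndex hk, le_sub_iff_add_le, ← mul_div_mul_left (k : ℚ) q two_ne_zero, ← add_div,
    div_le_one (by positivity)]
  exact_mod_cast Iff.rfl

theorem IsMCS.exists_stateTheory {Γ : Set Formula} (hΓ : IsMCS Γ) {q : ℕ} (hq : 1 ≤ q) :
    ∃ c ≤ 2 * q, ∃ b, ∀ φ, Over (multiples q) {n | n < 1} φ →
      (φ ∈ Γ ↔ φ ∈ stateTheory (c / (2 * q)) b) := by
  classical
  have hq' : (0 : ℚ) < q := by exact_mod_cast hq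
  obtain ⟨a, ha, hpos⟩ := hΓ.exists_threshold q (letter 0)
  obtain ⟨b, hb, hneg⟩ := hΓ.exists_threshold q (neg (letter 0))
  -- By `A5`, the bounds on p and ¬p cannot sum to more than one.
  have hab : a + b ≤ q := by
    by_contra! hlt
    refine hΓ.bel_neg_notMem ?_ ((hpos a ha).2 le_rfl) ((hneg b hb).2 le_rfl)
    rw [coe_gridIndex ha, coe_gridIndex hb, ← add_div, one_lt_div hq']
    exact_mod_cast hlt
  -- If p lacks weight (a+1)/q, then ¬p has the complementary weight, so q - (a+1) ≤ b.
  have hab' : q ≤ a + b + 1 := by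
    rcases ha.eq_or_lt with rfl | hlt
    · omega
    · have := (hneg (q - (a + 1)) (by omega)).1 (hΓ.bel_compl_mem (r := gridIndex q (a + 1)) ?_ ?_)
      · omega
      · rw [coe_gridIndex hlt, coe_gridIndex (by omega), ← add_div, ← Nat.cast_add,
          Nat.add_sub_cancel' hlt, div_self hq'.ne']
      · rw [hpos _ hlt]
        omega
  -- This number is 2a when a + b = q, the exact probability a/q, and 2a + 1 when a + b = q - 1, the
  -- midpoint of a/q and (a+1)/q.
  have hc : q + a - b ≤ 2 * q := by omega
  refine ⟨q + a - b, hc, decide (letter 0 ∈ Γ), fun φ hφ => ?_⟩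
  refine hΓ.mem_iff_of_single_letter (isMCS_stateTheory (by positivity) ?_ _) ?_
    (fun r hr => ?_) (fun r hr => ?_) hφ
  · exact div_le_one_of_le₀ (by exact_mod_cast hc) (by positivity)
  · simp [letter_mem_stateTheory]
  · obtain ⟨k, hk, rfl⟩ := exists_eq_gridIndex hq hr
    rw [hpos k hk, bel_letter_mem_stateTheory, gridIndex_le_div_iff hq hk]
    omega
  · obtain ⟨k, hk, rfl⟩ := exists_eq_gridIndex hq hr
    rw [hneg k hk, bel_neg_letter_mem_stateTheory, gridIndex_le_one_sub_div_iff hq hk]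
    omega

theorem ncard_omegaH_one {q d : ℕ} (hq : 1 ≤ q) (hd : 1 ≤ d) :
    (OmegaH q d 1).ncard = 2 * (2 * q + 1) := by
  let g : Bool × Fin (2 * q + 1) → Set Formula := fun x =>
    stateTheory ((x.2 : ℕ) / (2 * q)) x.1 ∩ localLanguage q d 1
  have hrange : OmegaH q d 1 = Set.range g := by
    rw [omegaH_eq_image]
    ext Θ
    constructor
    · rintro ⟨Γ, hΓ, rfl⟩
      obtain ⟨c, hc, b, h⟩ := IsMCS.exists_stateTheory hΓ hq
      refine ⟨(b, ⟨c, Nat.lt_succ_of_le hc⟩), ?_⟩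
      ext φ
      exact and_congr_left fun hφ => (h φ hφ.1).symm
    · rintro ⟨⟨b, c⟩, rfl⟩
      refine ⟨_, isMCS_stateTheory (by positivity) (div_le_one_of_le₀ ?_ (by positivity)) b, rfl⟩
      exact_mod_cast Nat.le_of_lt_succ c.2
  have hinj : Function.Injective g := by
    rintro ⟨b, c, hc⟩ ⟨b', c', hc'⟩ h
    have hmem : ∀ φ ∈ localLanguage q d 1, (φ ∈ stateTheory ((c : ℚ) / (2 * q)) b ↔
        φ ∈ stateTheory ((c' : ℚ) / (2 * q)) b') := fun φ hφ => by
      simpa [g, hφ] using Set.ext_iff.1 h φ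
    have hb := hmem (letter 0) ⟨Nat.one_pos, Nat.zero_le d⟩
    rw [letter_mem_stateTheory, letter_mem_stateTheory] at hb
    have hpos : ∀ k ≤ q, (2 * k ≤ c ↔ 2 * k ≤ c') := fun k hk => by
      have := hmem (bel (gridIndex q k) (letter 0))
        ⟨⟨gridIndex_mem_multiples q k, Nat.one_pos⟩, hd⟩
      rwa [bel_letter_mem_stateTheory, bel_letter_mem_stateTheory, gridIndex_le_div_iff hq hk,
        gridIndex_le_div_iff hq hk] at this
    have hneg : ∀ k ≤ q, (2 * k + c ≤ 2 * q ↔ 2 * k + c' ≤ 2 * q) := fun k hk => by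
      have := hmem (bel (gridIndex q k) (neg (letter 0)))
        ⟨⟨gridIndex_mem_multiples q k, Nat.one_pos⟩, hd⟩
      rwa [bel_neg_letter_mem_stateTheory, bel_neg_letter_mem_stateTheory,
        gridIndex_le_one_sub_div_iff hq hk, gridIndex_le_one_sub_div_iff hq hk] at this
    -- Bounds on p determine ⌊c/2⌋, and bounds on ¬p determine ⌊(2q - c)/2⌋, hence ⌈c/2⌉; together
    -- they give c.
    have hcc : c = c' := by
      have h1 := hpos (c / 2) (by omega)
      have h2 := hpos (c' / 2) (by omega)
      have h3 := hneg ((2 * q - c) / 2) (by omega)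
      have h4 := hneg ((2 * q - c') / 2) (by omega)
      omega
    subst hcc
    rw [Bool.eq_iff_iff.2 hb]
  rw [hrange, ← Set.image_univ, Set.ncard_image_of_injective _ hinj, Set.ncard_univ,
    Nat.card_prod]
  simp

end HarsanyiLogic

theorem mainTheorem2 :
    (∀ (I : Set HarsanyiLogic.Index) (P : Set ℕ), I.Finite → P.Finite →
      (HarsanyiLogic.canonicalSpace I P).Finite) ∧
    (∀ q d w : ℕ, 1 ≤ q → (HarsanyiLogic.OmegaH q d w).Finite) ∧
    (∀ q d w k : ℕ, 1 ≤ q → 1 ≤ d →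
      (HarsanyiLogic.OmegaH q d w).ncard = (HarsanyiLogic.OmegaH q (d + k) w).ncard) ∧
    (∀ q d : ℕ, 1 ≤ q → 1 ≤ d →
      (HarsanyiLogic.OmegaH q d 1).ncard = 2 * (2 * q + 1)) :=
  ⟨fun _ _ hI hP => HarsanyiLogic.finite_canonicalSpace hI hP,
    fun _ d w hq => HarsanyiLogic.finite_omegaH hq d w,
    fun q _ w k _ hd => HarsanyiLogic.ncard_omegaH_add q w k hd,
    fun _ _ hq hd => HarsanyiLogic.ncard_omegaH_one hq hd⟩
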